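/- Write $\mathrm{sign}(t)=1$ for $t\ge 0$ and $\mathrm{sign}(t)=-1$ for $t<0$. A degree-$d$ polynomial threshold function (PTF) on a domain $X\subseteq\mathbb{R}^n$ is a function $f:X\to\{-1,1\}$ of the form $f(x)=\mathrm{sign}(p(x))$, where $p$ is a real polynomial in $n$ variables of total degree at most $d$. For $f:\{-1,1\}^n\to\{-1,1\}$ and $0\le\epsilon\le1$ let $\mathrm{NS}_\epsilon(f)=\Pr[f(x)\neq f(y)]$, where $x$ is uniform on $\{-1,1\}^n$ and $y$ is obtained from $x$ by flipping each bit independently with probability $\epsilon$. For $f:\mathbb{R}^n\to\{-1,1\}$ let $\mathrm{GNS}_\epsilon(f)=\Pr[f(x)\neq f(y)]$, where $y=(1-\epsilon)x+\sqrt{2\epsilon-\epsilon^2}\,z$ and $x,z$ are independent standard Gaussian vectors in $\mathbb{R}^n$. Let $\mathrm{NS}(\epsilon,d)$ be the supremum of $\mathrm{NS}_\epsilon(f)$ over all $n$ and all degree-$d$ PTFs $f$ on $\{-1,1\}^n$, and let $\mathrm{GNS}(\epsilon,d)$ be the supremum of $\mathrm{GNS}_\epsilon(f)$ over all $n$ and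 all degree-$d$ PTFs $f$ on $\mathbb{R}^n$. **Proposition.** For all $\epsilon\in[0,1]$ and all integers $d\ge 0$, $$\mathrm{NS}(\epsilon,d)\ \ge\ \mathrm{GNS}(\epsilon,d).$$ The same inequality holds if Boolean noise at rate $\epsilon$ is instead understood as replacing each bit independently, with probability $\epsilon$, by a fresh uniform bit; since this flips each bit independently with probability $\epsilon/2$, it says that $$\mathrm{NS}(\epsilon/2,d)\ \ge\ \mathrm{GNS}(\epsilon,d).$$ -/

import Mathlib

open MeasureTheory ProbabilityTheory
open scoped ENNReal

namespace PTF

/-- The sign function with values in `{-1, 1}` (realised as the units of `ℤ`), with `sign 0 = 1`. -/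
noncomputable def sgn (t : ℝ) : ℤˣ := if 0 ≤ t then 1 else -1

/-- The Boolean hypercube `{-1, 1}ⁿ`. -/
abbrev Cube (n : ℕ) : Type := Fin n → ℤˣ

/-- Every subset of `{-1, 1}` is measurable. -/
instance instDiscreteMeasurableSpaceSign : DiscreteMeasurableSpace ℤˣ :=
  ⟨fun s => ⟨Units.val '' s, MeasurableSet.of_discrete,
    Set.preimage_image_eq s Units.val_injective⟩⟩

/-- The inclusion `{-1, 1}ⁿ ⊆ ℝⁿ`. -/
def Cube.toReal {n : ℕ} (x : Cube n) : Fin n → ℝ := fun i => ((x i : ℤ) : ℝ)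

/-- `f : {-1, 1}ⁿ → {-1, 1}` is a polynomial threshold function of degree (at most) `d`. -/
def IsBooleanPTF {n : ℕ} (d : ℕ) (f : Cube n → ℤˣ) : Prop :=
  ∃ p : MvPolynomial (Fin n) ℝ, p.totalDegree ≤ d ∧
    ∀ x : Cube n, f x = sgn (MvPolynomial.eval x.toReal p)

/-- `f : ℝⁿ → {-1, 1}` is a polynomial threshold function of degree (at most) `d`. -/
def IsGaussianPTF {n : ℕ} (d : ℕ) (f : (Fin n → ℝ) → ℤˣ) : Prop :=
  ∃ p : MvPolynomial (Fin n) ℝ, p.totalDegree ≤ d ∧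
    ∀ x : Fin n → ℝ, f x = sgn (MvPolynomial.eval x p)

/-- The law of a random sign which is `-1` with probability `ε` and `1` with probability `1 - ε`
(for `0 ≤ ε ≤ 1`). -/
noncomputable def signLaw (ε : ℝ) : Measure ℤˣ :=
  ENNReal.ofReal (1 - ε) • Measure.dirac 1 + ENNReal.ofReal ε • Measure.dirac (-1)

/-- The uniform distribution on `{-1, 1}ⁿ`: the coordinates are independent fair signs. -/
noncomputable def uniformCube (n : ℕ) : Measure (Cube n) :=
  Measure.pi fun _ => signLaw (1 / 2)

/-- The law of a flip pattern: every coordinate is independently `-1` (flip) with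
probability `ε` and `1` (keep) otherwise. -/
noncomputable def flipLaw (n : ℕ) (ε : ℝ) : Measure (Cube n) :=
  Measure.pi fun _ => signLaw ε

/-- Boolean noise sensitivity at noise rate `ε`: the probability that `f x ≠ f y`, where `x` is
uniform on `{-1, 1}ⁿ` and `y = x * s` arises from `x` by flipping each bit independently with
probability `ε`. -/
noncomputable def NS {n : ℕ} (ε : ℝ) (f : Cube n → ℤˣ) : ℝ≥0∞ :=
  ((uniformCube n).prod (flipLaw n ε)) {xs | f xs.1 ≠ f (xs.1 * xs.2)}

/-- The standard Gaussian distribution on `ℝⁿ`. -/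
noncomputable def gaussian (n : ℕ) : Measure (Fin n → ℝ) :=
  Measure.pi fun _ => gaussianReal 0 1

/-- Gaussian noise sensitivity at noise rate `ε`: the probability that `f x ≠ f y`, where
`y = (1 - ε) x + √(2 ε - ε²) z` with `x`, `z` independent standard Gaussian vectors. -/
noncomputable def GNS {n : ℕ} (ε : ℝ) (f : (Fin n → ℝ) → ℤˣ) : ℝ≥0∞ :=
  ((gaussian n).prod (gaussian n))
    {xz | f xz.1 ≠ f ((1 - ε) • xz.1 + √(2 * ε - ε ^ 2) • xz.2)}

/-- The maximal (supremal) Boolean noise sensitivity at noise rate `ε` of PTFs of degree `d`, over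
any number of variables. -/
noncomputable def maxNS (ε : ℝ) (d : ℕ) : ℝ≥0∞ :=
  ⨆ (n : ℕ) (f : Cube n → ℤˣ) (_ : IsBooleanPTF d f), NS ε f

/-- The maximal (supremal) Gaussian noise sensitivity at noise rate `ε` of PTFs of degree `d`, over
any number of variables. -/
noncomputable def maxGNS (ε : ℝ) (d : ℕ) : ℝ≥0∞ :=
  ⨆ (n : ℕ) (f : (Fin n → ℝ) → ℤˣ) (_ : IsGaussianPTF d f), GNS ε f

end PTF

namespace PTF


/-! A normalised sum of many random signs is nearly Gaussian, so a Gaussian PTF can be simulated on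
the cube: replace each variable of `p` by `(√M)⁻¹` times the sum of a block of `M` bits. This
substitution is linear and keeps the degree at most `d`. Flipping bits with probability `ε / 2`
gives correlation `1 - ε`, the correlation of the Gaussian pair, so the block sums of `x` and `y`
converge jointly to that pair (`measure_noisyGaussians_le_liminf`, via characteristic functions).
Strict disagreement `p(u) p(v) < 0` is an open condition, so the portmanteau theorem bounds its
Gaussian probability by the liminf of the Boolean ones. Gaussian ties `p = 0` are null when `p ≠ 0`
(`ae_eval_ne_zero`). This gives `maxGNS_le_maxNS_half`.

The bound at rate `ε` then follows from `maxNS_half_le_maxNS`: Boolean noise sensitivity is monotone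
in the rate up to `1 / 2` by its Fourier formula, and beyond that a dictator suffices. -/

/-! ### Fourier formula for Boolean noise sensitivity. -/

lemma isProbabilityMeasure_signLaw {ε : ℝ} (h0 : 0 ≤ ε) (h1 : ε ≤ 1) :
    IsProbabilityMeasure (signLaw ε) := by
  constructor
  rw [signLaw]
  simp only [Measure.coe_add, Measure.coe_smul, Pi.add_apply, Pi.smul_apply, measure_univ,
    smul_eq_mul, mul_one]
  rw [← ENNReal.ofReal_add (by linarith) h0]
  simp

lemma signLaw_real_singleton {ε : ℝ} (h0 : 0 ≤ ε) (h1 : ε ≤ 1) (s : ℤˣ) :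
    (signLaw ε).real {s} = (1 + (1 - 2 * ε) * ((s : ℤ) : ℝ)) / 2 := by
  have h1' : 0 ≤ 1 - ε := by linarith
  have h : (-1 : ℤˣ) ≠ 1 := by decide
  rcases Int.units_eq_one_or s with rfl | rfl
  · simp [signLaw, measureReal_def, h, h1', ENNReal.toReal_ofReal]
    ring
  · simp [signLaw, measureReal_def, h.symm, h0, ENNReal.toReal_ofReal]

lemma pi_signLaw_real_singleton {n : ℕ} {ε : ℝ} (h0 : 0 ≤ ε) (h1 : ε ≤ 1) (s : Cube n) :
    (Measure.pi fun _ : Fin n => signLaw ε).real {s} =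
      ∏ i, (1 + (1 - 2 * ε) * ((s i : ℤ) : ℝ)) / 2 := by
  have := isProbabilityMeasure_signLaw h0 h1
  rw [measureReal_def, Measure.pi_singleton, ENNReal.toReal_prod]
  exact Finset.prod_congr rfl fun i _ => signLaw_real_singleton h0 h1 _

/-- The product of the coordinates of `x` in `S`. -/
def walsh {n : ℕ} (S : Finset (Fin n)) (x : Cube n) : ℝ := ∏ i ∈ S, ((x i : ℤ) : ℝ)

/-- The Fourier expression of the noise stability at correlation `ρ`. -/
noncomputable def stability {n : ℕ} (ρ : ℝ) (f : Cube n → ℤˣ) : ℝ :=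
  (1 / 4) ^ n * ∑ S : Finset (Fin n), ρ ^ S.card * (∑ x, ((f x : ℤ) : ℝ) * walsh S x) ^ 2

lemma stability_nonneg {n : ℕ} {ρ : ℝ} (h : 0 ≤ ρ) (f : Cube n → ℤˣ) : 0 ≤ stability ρ f := by
  unfold stability; positivity

lemma stability_mono {n : ℕ} {ρ σ : ℝ} (h : 0 ≤ ρ) (hσ : ρ ≤ σ) (f : Cube n → ℤˣ) :
    stability ρ f ≤ stability σ f := by
  unfold stability; gcongr

/-- Expanding the product density of the noise over subsets `S` diagonalises the noise operator in
the Walsh basis, with eigenvalues `ρ ^ S.card`. -/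
lemma sum_sum_eq_stability {n : ℕ} (ρ : ℝ) (f : Cube n → ℤˣ) :
    ∑ x : Cube n, ∑ s : Cube n, (1 / 2) ^ n * (∏ i, (1 + ρ * ((s i : ℤ) : ℝ)) / 2) *
      (((f x : ℤ) : ℝ) * ((f (x * s) : ℤ) : ℝ)) = stability ρ f := by
  have key (x y : Cube n) : ∏ i, (1 + ρ * (((x⁻¹ * y) i : ℤ) : ℝ)) / 2 =
      (1 / 2) ^ n * ∑ S : Finset (Fin n), ρ ^ S.card * (walsh S x * walsh S y) := by
    simp_rw [div_eq_mul_inv _ (2 : ℝ)]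
    rw [Finset.prod_mul_distrib, Finset.prod_one_add, Finset.powerset_univ]
    simp only [Finset.prod_const, Finset.card_univ, Fintype.card_fin, Finset.prod_mul_distrib,
      Pi.mul_apply, Pi.inv_apply, Int.units_inv_eq_self, Units.val_mul, Int.cast_mul, walsh]
    rw [mul_comm, one_mul]
  -- Change of variables from the flip pattern `s` to the noisy copy `y = x * s`.
  have (x : Cube n) : ∑ s : Cube n, (1 / 2) ^ n * (∏ i, (1 + ρ * ((s i : ℤ) : ℝ)) / 2) *
      (((f x : ℤ) : ℝ) * ((f (x * s) : ℤ) : ℝ)) =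
      ∑ y : Cube n, (1 / 2) ^ n * (∏ i, (1 + ρ * (((x⁻¹ * y) i : ℤ) : ℝ)) / 2) *
        (((f x : ℤ) : ℝ) * ((f y : ℤ) : ℝ)) :=
    Fintype.sum_equiv (Equiv.mulLeft x) _ _ fun s => by
      simp only [Equiv.coe_mulLeft, inv_mul_cancel_left]
  have hR : stability ρ f = ∑ x, ∑ y, ∑ S : Finset (Fin n),
      (1 / 4) ^ n * (ρ ^ S.card * (((f x : ℤ) : ℝ) * walsh S x * (((f y : ℤ) : ℝ) * walsh S y))) := by
    simp_rw [stability, sq, Finset.sum_mul_sum, Finset.mul_sum]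
    rw [Finset.sum_comm]
    exact Finset.sum_congr rfl fun x _ => Finset.sum_comm
  simp_rw [hR, this, key, Finset.mul_sum, Finset.sum_mul]
  refine Finset.sum_congr rfl fun x _ => Finset.sum_congr rfl fun y _ =>
    Finset.sum_congr rfl fun S _ => ?_
  rw [show (1 / 4 : ℝ) = 1 / 2 * (1 / 2) by norm_num, mul_pow]
  ring

/-- For signs, the indicator of `f x ≠ f y` is `(1 - f x * f y) / 2`, and a bit and its noisy copy
have correlation `1 - 2 * ε`. -/
lemma NS_eq {n : ℕ} {ε : ℝ} (h0 : 0 ≤ ε) (h1 : ε ≤ 1) (f : Cube n → ℤˣ) :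
    NS ε f = ENNReal.ofReal ((1 - stability (1 - 2 * ε) f) / 2) := by
  have := isProbabilityMeasure_signLaw h0 h1
  have := isProbabilityMeasure_signLaw (ε := 1 / 2) (by norm_num) (by norm_num)
  have : IsProbabilityMeasure (uniformCube n) := by unfold uniformCube; infer_instance
  have : IsProbabilityMeasure (flipLaw n ε) := by unfold flipLaw; infer_instance
  set μ := (uniformCube n).prod (flipLaw n ε) with hμ
  have hstab : ∫ z, ((f z.1 : ℤ) : ℝ) * ((f (z.1 * z.2) : ℤ) : ℝ) ∂μ =
      stability (1 - 2 * ε) f := by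
    rw [integral_fintype .of_finite, Fintype.sum_prod_type, ← sum_sum_eq_stability]
    refine Finset.sum_congr rfl fun x _ => Finset.sum_congr rfl fun s _ => ?_
    rw [← Set.singleton_prod_singleton, hμ, measureReal_prod_prod, uniformCube, flipLaw,
      pi_signLaw_real_singleton h0 h1,
      pi_signLaw_real_singleton (by norm_num) (by norm_num), smul_eq_mul]
    simp
  have hind : ∫ z, (1 - ((f z.1 : ℤ) : ℝ) * ((f (z.1 * z.2) : ℤ) : ℝ)) / 2 ∂μ =
      μ.real {z | f z.1 ≠ f (z.1 * z.2)} := by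
    rw [← integral_indicator_one (Set.toFinite _).measurableSet]
    refine integral_congr_ae (.of_forall fun z => ?_)
    rcases Int.units_eq_one_or (f z.1) with h | h <;>
    rcases Int.units_eq_one_or (f (z.1 * z.2)) with h' | h' <;>
    norm_num [Set.indicator, h, h']
  rw [integral_div, integral_sub (integrable_const _) .of_finite, hstab] at hind
  rw [NS, ← ofReal_measureReal, ← hind]
  simp

lemma NS_le_NS_of_le_half {n : ℕ} {δ ε : ℝ} (h0 : 0 ≤ δ) (h : δ ≤ ε) (h1 : ε ≤ 1 / 2)
    (f : Cube n → ℤˣ) : NS δ f ≤ NS ε f := by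
  rw [NS_eq h0 (by linarith), NS_eq (h0.trans h) (by linarith)]
  have := stability_mono (ρ := 1 - 2 * ε) (σ := 1 - 2 * δ) (by linarith) (by linarith) f
  exact ENNReal.ofReal_le_ofReal (by linarith)

lemma NS_le_half {n : ℕ} {δ : ℝ} (h0 : 0 ≤ δ) (h : δ ≤ 1 / 2) (f : Cube n → ℤˣ) :
    NS δ f ≤ ENNReal.ofReal (1 / 2) := by
  rw [NS_eq h0 (by linarith)]
  have := stability_nonneg (ρ := 1 - 2 * δ) (by linarith) f
  exact ENNReal.ofReal_le_ofReal (by linarith)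

/-! ### Comparison of the rates `ε / 2` and `ε`. -/

lemma le_maxNS {n d : ℕ} (ε : ℝ) {f : Cube n → ℤˣ} (hf : IsBooleanPTF d f) :
    NS ε f ≤ maxNS ε d :=
  le_iSup_of_le n <| le_iSup₂_of_le f hf le_rfl

/-- The dictator `x ↦ x 0` changes exactly when its bit is flipped. -/
lemma ofReal_le_maxNS {ε : ℝ} (h0 : 0 ≤ ε) (h1 : ε ≤ 1) {d : ℕ} (hd : 1 ≤ d) :
    ENNReal.ofReal ε ≤ maxNS ε d := by
  have hf : IsBooleanPTF d (fun x : Cube 1 => x 0) := by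
    refine ⟨.X 0, by simpa using hd, fun x => ?_⟩
    rcases Int.units_eq_one_or (x 0) with h | h <;> norm_num [Cube.toReal, sgn, h]
  refine le_trans ?_ (le_maxNS ε hf)
  have := isProbabilityMeasure_signLaw h0 h1
  have := isProbabilityMeasure_signLaw (ε := 1 / 2) (by norm_num) (by norm_num)
  have : IsProbabilityMeasure (uniformCube 1) := by unfold uniformCube; infer_instance
  have hset : {z : Cube 1 × Cube 1 | z.1 0 ≠ (z.1 * z.2) 0} = Set.univ ×ˢ {fun _ => -1} := by
    ext z
    simp only [ne_eq, Pi.mul_apply, left_eq_mul, Set.mem_ofPred_eq, Set.mem_prod, Set.mem_univ,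
      Set.mem_singleton_iff, true_and, funext_iff, Fin.forall_fin_one]
    rcases Int.units_eq_one_or (z.2 0) with h | h <;> rw [h] <;> decide
  rw [NS, hset, Measure.prod_prod, measure_univ, one_mul, flipLaw, ← ofReal_measureReal,
    pi_signLaw_real_singleton h0 h1]
  refine ENNReal.ofReal_le_ofReal (le_of_eq ?_)
  simp

lemma IsBooleanPTF.NS_eq_zero {n : ℕ} {f : Cube n → ℤˣ} (hf : IsBooleanPTF 0 f) (ε : ℝ) :
    NS ε f = 0 := by
  obtain ⟨p, hp, hf⟩ := hf
  obtain ⟨c, rfl⟩ : ∃ c, p = .C c :=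
    ⟨_, MvPolynomial.totalDegree_eq_zero_iff_eq_C.1 (Nat.le_zero.1 hp)⟩
  simp [NS, hf]

/-- For `ε > 1 / 2` the correlation `1 - 2 * ε` is negative and monotonicity may fail; there the
chain is `NS (ε / 2) f ≤ 1 / 2 ≤ ε`, the last being attained by a dictator. Degree `0` is separate,
as it contains only constants. -/
lemma maxNS_half_le_maxNS {ε : ℝ} (h0 : 0 ≤ ε) (h1 : ε ≤ 1) (d : ℕ) :
    maxNS (ε / 2) d ≤ maxNS ε d := by
  refine iSup_le fun n => iSup₂_le fun f hf => ?_
  rcases Nat.eq_zero_or_pos d with rfl | hd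
  · simp [hf.NS_eq_zero]
  rcases le_total ε (1 / 2) with h | h
  · exact (NS_le_NS_of_le_half (by linarith) (by linarith) h f).trans (le_maxNS ε hf)
  · exact (NS_le_half (by linarith) (by linarith) f).trans <|
      (ENNReal.ofReal_le_ofReal h).trans (ofReal_le_maxNS h0 h1 hd)

/-! ### Zero sets of polynomials are null. -/

lemma eval_bind₁ {σ τ : Type*} (x : τ → ℝ) (g : σ → MvPolynomial τ ℝ) (p : MvPolynomial σ ℝ) :
    MvPolynomial.eval x (MvPolynomial.bind₁ g p) =
      MvPolynomial.eval (fun i => MvPolynomial.eval x (g i)) p :=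
  MvPolynomial.eval₂Hom_bind₁ _ _ _ _

lemma measurable_eval {n : ℕ} (p : MvPolynomial (Fin n) ℝ) :
    Measurable fun x : Fin n → ℝ => MvPolynomial.eval x p :=
  p.continuous_eval.measurable

/-- A nonzero polynomial is almost surely nonzero under a product of atomless measures. -/
lemma ae_eval_ne_zero (μ : Measure ℝ) [SigmaFinite μ] [NullSingletonClass μ] :
    ∀ {n : ℕ} {p : MvPolynomial (Fin n) ℝ}, p ≠ 0 →
      ∀ᵐ x ∂(Measure.pi fun _ : Fin n => μ), MvPolynomial.eval x p ≠ 0 := by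
  intro n
  induction n with
  | zero =>
    intro p hp
    refine .of_forall fun x hx => hp ?_
    rw [MvPolynomial.eq_C_of_isEmpty p] at hx ⊢
    simp_all
  | succ n ih =>
    intro p hp
    have hmp := measurePreserving_piFinSuccAbove (fun _ : Fin (n + 1) => μ) 0
    have hms : MeasurableSet {z : ℝ × (Fin n → ℝ) |
        MvPolynomial.eval (Fin.cons z.1 z.2 : Fin (n + 1) → ℝ) p ≠ 0} := by
      refine ((measurable_eval p).comp (g := fun x => _) ?_) (measurableSet_singleton 0).compl
      refine measurable_pi_iff.2 fun i => ?_
      refine Fin.cases ?_ (fun i => ?_) i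
      · simpa using measurable_fst
      · simp only [Fin.cons_succ]
        fun_prop
    have hprod : ∀ᵐ z ∂(μ.prod (Measure.pi fun _ : Fin n => μ)),
        MvPolynomial.eval (Fin.cons z.1 z.2 : Fin (n + 1) → ℝ) p ≠ 0 := by
      -- Freeze the last `n` coordinates `y` first. For almost every `y` the leading coefficient in
      -- the remaining variable is nonzero by induction, which leaves finitely many roots.
      rw [Measure.ae_prod_iff_ae_ae hms, Measure.ae_ae_comm hms]
      have hl : (MvPolynomial.finSuccEquiv ℝ n p).leadingCoeff ≠ 0 := by simpa using hp
      filter_upwards [ih hl] with y hy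
      set q := (MvPolynomial.finSuccEquiv ℝ n p).map (MvPolynomial.eval y) with hq
      have hq0 : q ≠ 0 := fun h => hy <| by
        simpa [hq, Polynomial.coeff_map] using
          congrArg (Polynomial.coeff · (MvPolynomial.finSuccEquiv ℝ n p).natDegree) h
      have : {t | q.eval t = 0}.Finite := by
        simpa [Polynomial.IsRoot] using Polynomial.finite_setOfPred_isRoot hq0
      filter_upwards [measure_eq_zero_iff_ae_notMem.1 (this.measure_zero μ)] with t ht
      simpa [MvPolynomial.eval_eq_eval_mv_eval'] using ht
    filter_upwards [hmp.quasiMeasurePreserving.ae hprod] with x hx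
    have hcons : (Fin.cons (x 0) (fun i => x i.succ) : Fin (n + 1) → ℝ) = x :=
      Fin.cons_self_tail x
    simpa [MeasurableEquiv.piFinSuccAbove, Fin.insertNthEquiv, Fin.removeNth, hcons] using hx

lemma ae_eval_affine_ne_zero (μ : Measure ℝ) [SigmaFinite μ] [NullSingletonClass μ] {n : ℕ}
    {p : MvPolynomial (Fin n) ℝ} (hp : p ≠ 0) {a : ℝ} (ha : a ≠ 0) (v : Fin n → ℝ) :
    ∀ᵐ x ∂(Measure.pi fun _ : Fin n => μ), MvPolynomial.eval (a • x + v) p ≠ 0 := by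
  set q := MvPolynomial.bind₁ (fun i => .C a * .X i + .C (v i)) p with hq
  have heval (x : Fin n → ℝ) : MvPolynomial.eval x q = MvPolynomial.eval (a • x + v) p := by
    rw [hq, eval_bind₁]
    congr 2
    ext i
    simp
  have hq0 : q ≠ 0 := by
    intro h
    refine hp (MvPolynomial.funext fun w => ?_)
    -- The affine map is invertible as `a ≠ 0`; this is the preimage of `w`.
    have := heval (a⁻¹ • (w - v))
    rw [h, smul_inv_smul₀ ha] at this
    simpa using this.symm
  filter_upwards [ae_eval_ne_zero μ hq0] with x hx
  rwa [heval] at hx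

/-! ### Characteristic functions of one coordinate pair. -/

open Filter Topology Complex

/-- A pair of independent product vectors is a vector of independent pairs, so the integral factors
over coordinates. -/
lemma integral_prod_pi_prod {ι α β : Type*} [Fintype ι] [MeasurableSpace α] [MeasurableSpace β]
    (μ : Measure α) (ν : Measure β) [SigmaFinite μ] [SigmaFinite ν] (F : ι → α → β → ℂ) :
    ∫ z, ∏ k, F k (z.1 k) (z.2 k) ∂((Measure.pi fun _ => μ).prod (Measure.pi fun _ => ν)) =
      ∏ k, ∫ w, F k w.1 w.2 ∂(μ.prod ν) := by
  rw [← (measurePreserving_arrowProdEquivProdArrow α β ι (fun _ => μ) fun _ => ν).integral_comp',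
    ← integral_fintype_prod_eq_prod]
  rfl

lemma integral_exp_signLaw_prod {ε : ℝ} (h0 : 0 ≤ ε) (h1 : ε ≤ 1) (a b : ℝ) :
    ∫ w, cexp (((a * ((w.1 : ℤ) : ℝ) + b * ((w.1 * w.2 : ℤ) : ℝ) : ℝ) : ℂ) * I)
      ∂((signLaw (1 / 2)).prod (signLaw ε)) =
      (((1 - ε) * Real.cos (a + b) + ε * Real.cos (a - b) : ℝ) : ℂ) := by
  have := isProbabilityMeasure_signLaw h0 h1
  have := isProbabilityMeasure_signLaw (ε := 1 / 2) (by norm_num) (by norm_num)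
  have hu : (Finset.univ : Finset ℤˣ) = {1, -1} := by decide
  rw [integral_fintype .of_finite, Fintype.sum_prod_type]
  simp_rw [← Set.singleton_prod_singleton, measureReal_prod_prod, hu]
  rw [Finset.sum_pair (by decide), Finset.sum_pair (by decide), Finset.sum_pair (by decide)]
  simp_rw [signLaw_real_singleton h0 h1,
    signLaw_real_singleton (ε := 1 / 2) (by norm_num) (by norm_num)]
  push_cast
  rw [Complex.cos, Complex.cos]
  simp only [Complex.real_smul]
  push_cast
  ring_nf

/-- Since `cos (c / √M) = 1 - c ^ 2 / (2 * M) + o(1 / M)` and `(1 - ε) (a + b)² + ε (a - b)² = a² +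
b² + 2 (1 - 2 ε) a b`, this is an instance of `(1 + z / M + o(1 / M)) ^ M → exp z`. -/
lemma tendsto_pow_cos_mixture (ε a b : ℝ) :
    Tendsto (fun M : ℕ => (((1 - ε) * Real.cos ((√M)⁻¹ * a + (√M)⁻¹ * b) +
        ε * Real.cos ((√M)⁻¹ * a - (√M)⁻¹ * b) : ℝ) : ℂ) ^ M) atTop
      (𝓝 (cexp ((-((a ^ 2 + b ^ 2 + 2 * (1 - 2 * ε) * (a * b)) / 2) : ℝ) : ℂ))) := by
  have hcos (c : ℝ) : (fun M : ℕ => Real.cos ((√M)⁻¹ * c) - (1 - c ^ 2 / 2 * (1 / (M : ℝ))))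
      =o[atTop] fun M : ℕ => 1 / (M : ℝ) := by
    have ht : Tendsto (fun M : ℕ => (√(M : ℝ))⁻¹ * c) atTop (𝓝 0) := by
      rw [← zero_mul c]
      exact .mul_const c (tendsto_inv_atTop_zero.comp <| Real.tendsto_sqrt_atTop.comp <|
        tendsto_natCast_atTop_atTop)
    have hO : (fun x : ℝ => Real.cos x - (1 - x ^ 2 / 2)) =O[𝓝 0] fun x => x ^ 4 := by
      refine .of_bound (5 / 96) ?_
      have : ∀ᶠ x : ℝ in 𝓝 0, |x| < 1 := by
        simpa using (continuous_abs.tendsto (0 : ℝ)).eventually (gt_mem_nhds (by simp))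
      filter_upwards [this] with x hx
      simpa [mul_comm] using Real.cos_bound hx.le
    have ho : (fun x : ℝ => Real.cos x - (1 - x ^ 2 / 2)) =o[𝓝 0] fun x => x ^ 2 :=
      hO.trans_isLittleO (Asymptotics.isLittleO_pow_pow (by norm_num))
    have := ho.comp_tendsto ht
    refine (this.congr (fun M => ?_) (g₂ := fun M : ℕ => c ^ 2 * (1 / (M : ℝ)))
      (fun M => ?_)).trans_isBigO (Asymptotics.isBigO_const_mul_self _ _ _)
    · simp [mul_pow]; ring
    · simp [mul_pow]; ring
  have hmain : (fun M : ℕ => ((1 - ε) * Real.cos ((√M)⁻¹ * a + (√M)⁻¹ * b) +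
        ε * Real.cos ((√M)⁻¹ * a - (√M)⁻¹ * b)) -
          (1 + -((a ^ 2 + b ^ 2 + 2 * (1 - 2 * ε) * (a * b)) / 2) / (M : ℝ)))
      =o[atTop] fun M : ℕ => 1 / (M : ℝ) := by
    refine (((hcos (a + b)).const_mul_left (1 - ε)).add
      ((hcos (a - b)).const_mul_left ε)).congr_left fun M => ?_
    rw [mul_add, mul_sub]
    ring_nf
  refine tendsto_pow_exp_of_isLittleO_sub_add_div _ ?_
  rw [← Asymptotics.isLittleO_norm_norm] at hmain ⊢
  refine hmain.congr (fun M => ?_) (fun M => ?_)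
  · rw [← Complex.norm_real]; push_cast; rfl
  · simp

lemma integral_exp_gaussianReal_prod {ε : ℝ} (h0 : 0 ≤ ε) (h1 : ε ≤ 1) (a b : ℝ) :
    ∫ w, cexp (((a * w.1 + b * ((1 - ε) * w.1 + √(2 * ε - ε ^ 2) * w.2) : ℝ) : ℂ) * I)
      ∂((gaussianReal 0 1).prod (gaussianReal 0 1)) =
      cexp ((-((a ^ 2 + b ^ 2 + 2 * (1 - ε) * (a * b)) / 2) : ℝ) : ℂ) := by
  set c := √(2 * ε - ε ^ 2) with hc
  have hc2 : c ^ 2 = 2 * ε - ε ^ 2 := Real.sq_sqrt (by nlinarith)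
  have (w : ℝ × ℝ) : cexp (((a * w.1 + b * ((1 - ε) * w.1 + c * w.2) : ℝ) : ℂ) * I) =
      cexp (((a + b * (1 - ε) : ℝ) : ℂ) * w.1 * I) * cexp (((b * c : ℝ) : ℂ) * w.2 * I) := by
    rw [← Complex.exp_add]; push_cast; ring_nf
  simp_rw [this]
  rw [integral_prod_mul (fun x : ℝ => cexp (((a + b * (1 - ε) : ℝ) : ℂ) * x * I))
    (fun x : ℝ => cexp (((b * c : ℝ) : ℂ) * x * I)), ← charFun_apply_real, ← charFun_apply_real,
    charFun_gaussianReal, charFun_gaussianReal, ← Complex.exp_add]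
  congr 1
  have hc2' : (c : ℂ) ^ 2 = 2 * ε - ε ^ 2 := by exact_mod_cast congrArg Complex.ofReal hc2
  push_cast
  -- The coefficient of `b²` is right because `(1 - ε)² + c² = 1`.
  linear_combination (-(b : ℂ) ^ 2 / 2) * hc2'

/-! ### Joint central limit theorem for block sums. -/

/-- The pair `(u, v)` as a point of a Euclidean space. -/
noncomputable def pairVec {n : ℕ} (z : (Fin n → ℝ) × (Fin n → ℝ)) :
    EuclideanSpace ℝ (Fin n ⊕ Fin n) :=
  WithLp.toLp 2 (Sum.elim z.1 z.2)

lemma continuous_pairVec {n : ℕ} : Continuous (pairVec (n := n)) := by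
  refine (PiLp.continuous_toLp 2 _).comp (continuous_pi fun i => ?_)
  rcases i with i | i <;> simp <;> fun_prop

lemma exp_inner_pairVec {n : ℕ} (z : (Fin n → ℝ) × (Fin n → ℝ))
    (t : EuclideanSpace ℝ (Fin n ⊕ Fin n)) :
    cexp (((inner ℝ (pairVec z) t : ℝ) : ℂ) * I) =
      ∏ i, cexp (((t (.inl i) * z.1 i + t (.inr i) * z.2 i : ℝ) : ℂ) * I) := by
  rw [← Complex.exp_sum, ← Finset.sum_mul, ← Complex.ofReal_sum, Finset.sum_add_distrib]
  simp [pairVec, PiLp.inner_apply]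

/-- Normalised sums of the `n` blocks of `M` coordinates. -/
noncomputable def blockSum {n M : ℕ} (x : Fin (n * M) → ℝ) (i : Fin n) : ℝ :=
  (√M)⁻¹ * ∑ j : Fin M, x (finProdFinEquiv (i, j))

/-- The block sums of a Boolean vector and of its noisy copy. -/
noncomputable def noisyBlockSums (n M : ℕ) (z : Cube (n * M) × Cube (n * M)) :
    (Fin n → ℝ) × (Fin n → ℝ) :=
  (blockSum z.1.toReal, blockSum (z.1 * z.2).toReal)

/-- A Gaussian vector and its noisy copy. -/
noncomputable def noisyGaussians (n : ℕ) (ε : ℝ) (z : (Fin n → ℝ) × (Fin n → ℝ)) :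
    (Fin n → ℝ) × (Fin n → ℝ) :=
  (z.1, (1 - ε) • z.1 + √(2 * ε - ε ^ 2) • z.2)

lemma charFun_noisyGaussians {n : ℕ} {ε : ℝ} (h0 : 0 ≤ ε) (h1 : ε ≤ 1)
    (t : EuclideanSpace ℝ (Fin n ⊕ Fin n)) :
    charFun (((gaussian n).prod (gaussian n)).map (pairVec ∘ noisyGaussians n ε)) t =
      ∏ i, cexp ((-((t (.inl i) ^ 2 + t (.inr i) ^ 2 +
        2 * (1 - ε) * (t (.inl i) * t (.inr i))) / 2) : ℝ) : ℂ) := by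
  have hm : Measurable (pairVec ∘ noisyGaussians n ε) :=
    continuous_pairVec.measurable.comp (by unfold noisyGaussians; fun_prop)
  rw [charFun_apply, integral_map hm.aemeasurable (by fun_prop)]
  simp_rw [Function.comp_apply, exp_inner_pairVec, ← integral_exp_gaussianReal_prod h0 h1]
  exact integral_prod_pi_prod (gaussianReal 0 1) (gaussianReal 0 1)
    fun i x z => cexp (((t (.inl i) * x + t (.inr i) *
      ((1 - ε) * x + √(2 * ε - ε ^ 2) * z) : ℝ) : ℂ) * I)

lemma charFun_noisyBlockSums {n M : ℕ} {ε : ℝ} (h0 : 0 ≤ ε) (h1 : ε ≤ 1)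
    (t : EuclideanSpace ℝ (Fin n ⊕ Fin n)) :
    charFun (((uniformCube (n * M)).prod (flipLaw (n * M) ε)).map
      (pairVec ∘ noisyBlockSums n M)) t =
      ∏ i, (((1 - ε) * Real.cos ((√M)⁻¹ * t (.inl i) + (√M)⁻¹ * t (.inr i)) +
        ε * Real.cos ((√M)⁻¹ * t (.inl i) - (√M)⁻¹ * t (.inr i)) : ℝ) : ℂ) ^ M := by
  have := isProbabilityMeasure_signLaw h0 h1
  have := isProbabilityMeasure_signLaw (ε := 1 / 2) (by norm_num) (by norm_num)
  have hm : Measurable (pairVec ∘ noisyBlockSums n M) := .of_discrete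
  rw [charFun_apply, integral_map hm.aemeasurable (by fun_prop)]
  have hF (z : Cube (n * M) × Cube (n * M)) :
      cexp (((inner ℝ (pairVec (noisyBlockSums n M z)) t : ℝ) : ℂ) * I) =
        ∏ k, (fun (x s : ℤˣ) => cexp ((((√M)⁻¹ * t (.inl (finProdFinEquiv.symm k).1) *
          ((x : ℤ) : ℝ) + (√M)⁻¹ * t (.inr (finProdFinEquiv.symm k).1) *
          ((x * s : ℤ) : ℝ) : ℝ) : ℂ) * I)) (z.1 k) (z.2 k) := by
    rw [exp_inner_pairVec, ← finProdFinEquiv.prod_comp, Fintype.prod_prod_type]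
    refine Finset.prod_congr rfl fun i _ => ?_
    rw [← Complex.exp_sum, ← Finset.sum_mul, ← Complex.ofReal_sum]
    congr 3
    simp only [noisyBlockSums, blockSum, Cube.toReal, Finset.mul_sum, ← Finset.sum_add_distrib,
      Equiv.symm_apply_apply, Pi.mul_apply, Units.val_mul]
    exact Finset.sum_congr rfl fun j _ => by ring
  simp_rw [Function.comp_apply, hF]
  rw [uniformCube, flipLaw, integral_prod_pi_prod (signLaw (1 / 2)) (signLaw ε)
    (fun k (x s : ℤˣ) => cexp ((((√M)⁻¹ * t (.inl (finProdFinEquiv.symm k).1) *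
          ((x : ℤ) : ℝ) + (√M)⁻¹ * t (.inr (finProdFinEquiv.symm k).1) *
          ((x * s : ℤ) : ℝ) : ℝ) : ℂ) * I))]
  simp_rw [integral_exp_signLaw_prod h0 h1]
  rw [← finProdFinEquiv.prod_comp, Fintype.prod_prod_type]
  simp

/-- A central limit theorem for the block sums of a Boolean vector and of its noisy copy. -/
lemma measure_noisyGaussians_le_liminf {n : ℕ} {ε : ℝ} (h0 : 0 ≤ ε) (h1 : ε ≤ 1)
    {U : Set (EuclideanSpace ℝ (Fin n ⊕ Fin n))} (hU : IsOpen U) :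
    ((gaussian n).prod (gaussian n)) ((pairVec ∘ noisyGaussians n ε) ⁻¹' U) ≤
      liminf (fun M : ℕ => ((uniformCube (n * M)).prod (flipLaw (n * M) (ε / 2)))
        ((pairVec ∘ noisyBlockSums n M) ⁻¹' U)) atTop := by
  have := isProbabilityMeasure_signLaw (ε := ε / 2) (by linarith) (by linarith)
  have := isProbabilityMeasure_signLaw (ε := 1 / 2) (by norm_num) (by norm_num)
  have (M : ℕ) : IsProbabilityMeasure (uniformCube M) := by unfold uniformCube; infer_instance
  have (M : ℕ) : IsProbabilityMeasure (flipLaw M (ε / 2)) := by unfold flipLaw; infer_instance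
  have : IsProbabilityMeasure (gaussian n) := by unfold gaussian; infer_instance
  have hm : Measurable (pairVec ∘ noisyGaussians n ε) :=
    continuous_pairVec.measurable.comp (by unfold noisyGaussians; fun_prop)
  have hmB (M : ℕ) : Measurable (pairVec ∘ noisyBlockSums n M) := .of_discrete
  let μ (M : ℕ) : ProbabilityMeasure (EuclideanSpace ℝ (Fin n ⊕ Fin n)) :=
    ⟨_, Measure.isProbabilityMeasure_map
      (μ := (uniformCube (n * M)).prod (flipLaw (n * M) (ε / 2))) (hmB M).aemeasurable⟩
  let ν : ProbabilityMeasure (EuclideanSpace ℝ (Fin n ⊕ Fin n)) :=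
    ⟨_, Measure.isProbabilityMeasure_map
      (μ := (gaussian n).prod (gaussian n)) hm.aemeasurable⟩
  have hlim : Tendsto μ atTop (𝓝 ν) := by
    refine ProbabilityMeasure.tendsto_of_tendsto_charFun fun t => ?_
    simp only [μ, ν, ProbabilityMeasure.coe_mk, charFun_noisyGaussians h0 h1,
      charFun_noisyBlockSums (ε := ε / 2) (by linarith) (by linarith)]
    refine tendsto_finsetProd _ fun i _ => ?_
    have := tendsto_pow_cos_mixture (ε / 2) (t (.inl i)) (t (.inr i))
    -- The covariances match: `1 - 2 * (ε / 2) = 1 - ε`.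
    rwa [mul_div_cancel₀ ε two_ne_zero] at this
  have := ProbabilityMeasure.le_liminf_measure_open_of_tendsto hlim hU
  simpa only [μ, ν, ProbabilityMeasure.coe_mk, Measure.map_apply hm hU.measurableSet,
    Measure.map_apply (hmB _) hU.measurableSet] using this

/-! ### Transfer of threshold functions from Gaussian space to the cube. -/

lemma totalDegree_bind₁_le {σ τ : Type*} (p : MvPolynomial σ ℝ) {g : σ → MvPolynomial τ ℝ}
    (hg : ∀ i, (g i).totalDegree ≤ 1) :
    (MvPolynomial.bind₁ g p).totalDegree ≤ p.totalDegree := by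
  conv_lhs => rw [p.as_sum, map_sum]
  refine MvPolynomial.totalDegree_finsetSum_le fun s hs => ?_
  rw [MvPolynomial.bind₁_monomial]
  refine (MvPolynomial.totalDegree_mul _ _).trans ?_
  rw [MvPolynomial.totalDegree_C, zero_add]
  refine (MvPolynomial.totalDegree_finsetProd _ _).trans ?_
  refine le_trans (Finset.sum_le_sum fun i _ => ?_) (MvPolynomial.le_totalDegree hs)
  refine (MvPolynomial.totalDegree_pow _ _).trans ?_
  simpa using Nat.mul_le_mul_left (s i) (hg i)

lemma isBooleanPTF_blockSum {n d : ℕ} (M : ℕ) {p : MvPolynomial (Fin n) ℝ}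
    (hp : p.totalDegree ≤ d) :
    IsBooleanPTF d fun x : Cube (n * M) => sgn (MvPolynomial.eval (blockSum x.toReal) p) := by
  refine ⟨MvPolynomial.bind₁
    (fun i => .C (√M)⁻¹ * ∑ j : Fin M, .X (finProdFinEquiv (i, j))) p,
    (totalDegree_bind₁_le p fun i => ?_).trans hp, fun x => ?_⟩
  · refine (MvPolynomial.totalDegree_mul _ _).trans ?_
    rw [MvPolynomial.totalDegree_C, zero_add]
    exact MvPolynomial.totalDegree_finsetSum_le fun j _ => by simp
  · rw [eval_bind₁]
    have (i : Fin n) : MvPolynomial.eval x.toReal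
        (.C (√M)⁻¹ * ∑ j : Fin M, .X (finProdFinEquiv (i, j))) = blockSum x.toReal i := by
      simp [blockSum]
    simp_rw [this]

lemma sgn_ne_sgn_of_mul_neg {a b : ℝ} (h : a * b < 0) : sgn a ≠ sgn b := by
  rcases mul_neg_iff.1 h with ⟨ha, hb⟩ | ⟨ha, hb⟩
  · simp [sgn, ha.le, hb.not_ge]
  · simp [sgn, hb.le, ha.not_ge]

lemma mul_neg_of_sgn_ne_sgn {a b : ℝ} (ha : a ≠ 0) (hb : b ≠ 0) (h : sgn a ≠ sgn b) :
    a * b < 0 := by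
  by_contra! hab
  rcases ha.lt_or_gt with ha' | ha' <;> rcases hb.lt_or_gt with hb' | hb'
  · exact h (by simp [sgn, ha'.not_ge, hb'.not_ge])
  · exact (mul_neg_of_neg_of_pos ha' hb').not_ge hab
  · exact (mul_neg_of_pos_of_neg ha' hb').not_ge hab
  · exact h (by simp [sgn, ha'.le, hb'.le])

lemma ae_noisyGaussians_ne_zero {n : ℕ} {ε : ℝ} {p : MvPolynomial (Fin n) ℝ} (hp : p ≠ 0) :
    ∀ᵐ z ∂((gaussian n).prod (gaussian n)),
      MvPolynomial.eval (noisyGaussians n ε z).1 p ≠ 0 ∧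
        MvPolynomial.eval (noisyGaussians n ε z).2 p ≠ 0 := by
  have : IsProbabilityMeasure (gaussian n) := by unfold gaussian; infer_instance
  have : NullSingletonClass (gaussianReal 0 1) := nullSingletonClass_gaussianReal one_ne_zero
  have hm : Measurable (noisyGaussians n ε) := by unfold noisyGaussians; fun_prop
  refine Filter.Eventually.and ?_ ?_
  · exact Measure.quasiMeasurePreserving_fst.ae (ae_eval_ne_zero (gaussianReal 0 1) hp)
  have hms : MeasurableSet {z : (Fin n → ℝ) × (Fin n → ℝ) |
      MvPolynomial.eval ((1 - ε) • z.1 + √(2 * ε - ε ^ 2) • z.2) p ≠ 0} :=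
    ((measurable_eval p).comp hm.snd) (measurableSet_singleton 0).compl
  refine (Measure.ae_prod_iff_ae_ae hms).2 ?_
  -- At `ε = 1` the noisy copy is `z` itself. Otherwise fix `z` and vary `x`, whose coefficient `1 -
  -- ε` is nonzero.
  by_cases h : ε = 1
  · subst h
    refine .of_forall fun x => ?_
    filter_upwards [ae_eval_ne_zero (gaussianReal 0 1) hp] with z hz
    norm_num [hz]
  · refine (Measure.ae_ae_comm (p := fun x z : Fin n → ℝ =>
      MvPolynomial.eval ((1 - ε) • x + √(2 * ε - ε ^ 2) • z) p ≠ 0) hms).2 ?_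
    exact .of_forall fun z =>
      ae_eval_affine_ne_zero (gaussianReal 0 1) hp (sub_ne_zero.2 (Ne.symm h)) _

lemma maxGNS_le_maxNS_half {ε : ℝ} (h0 : 0 ≤ ε) (h1 : ε ≤ 1) (d : ℕ) :
    maxGNS ε d ≤ maxNS (ε / 2) d := by
  refine iSup_le fun n => iSup₂_le fun f hf => ?_
  obtain ⟨p, hpd, hf⟩ := hf
  rcases eq_or_ne p 0 with rfl | hp
  · simp [GNS, hf]
  -- Disagreement of `sgn` need not be open, but strict disagreement is. The two agree almost surely
  -- on the Gaussian side; on the Boolean side, where ties can have positive mass, only the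
  -- inclusion of strict disagreement in disagreement is needed.
  let U : Set (EuclideanSpace ℝ (Fin n ⊕ Fin n)) :=
    {v | MvPolynomial.eval (fun i => v (.inl i)) p * MvPolynomial.eval (fun i => v (.inr i)) p < 0}
  have hU : IsOpen U := by
    refine isOpen_lt (.mul ?_ ?_) continuous_const
    · exact p.continuous_eval.comp (by fun_prop)
    · exact p.continuous_eval.comp (by fun_prop)
  have hGU : GNS ε f ≤ ((gaussian n).prod (gaussian n))
      ((pairVec ∘ noisyGaussians n ε) ⁻¹' U) := by
    refine measure_mono_ae ?_
    filter_upwards [ae_noisyGaussians_ne_zero (ε := ε) hp] with z hz hne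
    exact mul_neg_of_sgn_ne_sgn hz.1 hz.2 ((hf _).symm.trans_ne (Ne.trans_eq hne (hf _)))
  refine (hGU.trans (measure_noisyGaussians_le_liminf h0 h1 hU)).trans ?_
  refine (liminf_le_liminf (v := fun _ => maxNS (ε / 2) d) (.of_forall fun M => ?_)).trans_eq
    (liminf_const _)
  refine le_trans (measure_mono fun z hz => ?_) (le_maxNS (ε / 2) (isBooleanPTF_blockSum M hpd))
  exact sgn_ne_sgn_of_mul_neg hz

end PTF

theorem mainTheorem11 (ε : ℝ) (hε0 : 0 ≤ ε) (hε1 : ε ≤ 1) (d : ℕ) :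
    PTF.maxGNS ε d ≤ PTF.maxNS ε d ∧ PTF.maxGNS ε d ≤ PTF.maxNS (ε / 2) d :=
  have h := PTF.maxGNS_le_maxNS_half hε0 hε1 d
  ⟨h.trans (PTF.maxNS_half_le_maxNS hε0 hε1 d), h⟩
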